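/- For $m\in\mathbb{Z}$ let $\lambda_m=-im(m^4+m^2-1)$. There exist constants $T>2\pi$, $b>0$, $C>0$ and a sequence $(\zeta_m)_{m\in\mathbb{Z}}$ in $L^2(-\frac T2,\frac T2)$ (complex-valued functions) which is biorthogonal to $(e^{-\lambda_m t})_{m\in\mathbb{Z}}$, that is, $$\int_{-T/2}^{T/2}\zeta_m(t)\,\overline{e^{-\lambda_n t}}\,dt=\delta_{mn}\qquad\text{for all } m,n\in\mathbb{Z},$$ such that, for every sequence $(c_m)_{m\in\mathbb{Z}}$ of complex numbers with $\sum_{m\in\mathbb{Z}}|c_m|^2e^{2bm^6}<\infty$, the series $\sum_{m\in\mathbb{Z}}c_m\zeta_m$ converges unconditionally in $L^2(-\frac T2,\frac T2)$ and $$\int_{-T/2}^{T/2}\Big|\sum_{m\in\mathbb{Z}}c_m\zeta_m(t)\Big|^2dt\le C\sum_{m\in\mathbb{Z}}|c_m|^2e^{2bm^6}.$$ -/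

import Mathlib

open MeasureTheory

noncomputable section

/-- `λ_m = -i m (m⁴ + m² - 1)`. -/
def kawaharaEigenvalue (m : ℤ) : ℂ :=
  -Complex.I * (m : ℂ) * ((m : ℂ) ^ 4 + (m : ℂ) ^ 2 - 1)

/-- The complex Hilbert space `L²(-T/2, T/2)`. -/
abbrev SymmL2 (T : ℝ) : Type :=
  Lp ℂ 2 (volume.restrict (Set.Ioo (-(T / 2)) (T / 2)))

/-- The sequence `ζ` is biorthogonal to the family of functions `e` in `L²(-T/2, T/2)`:
`∫_{-T/2}^{T/2} ζ_m(t) * conj (e_n(t)) dt = δ_{mn}` for all `m`, `n`. -/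
def IsBiorthogonal (T : ℝ) (ζ : ℤ → SymmL2 T) (e : ℤ → ℝ → ℂ) : Prop :=
  ∀ m n : ℤ,
    ∫ t in Set.Ioo (-(T / 2)) (T / 2), (ζ m) t * (starRingEnd ℂ) (e n t) =
      if m = n then 1 else 0

end

/-! Each `-λ_m` is `i` times an integer, and these integers are distinct, so the exponentials are
orthogonal on any interval whose length is a multiple of `2π`. On length `4π` they are, up to the
factor `1/(4π)`, their own biorthogonal family (`isBiorthogonal_kawaharaExp`). Orthonormality after
scaling gives convergence and the bound for square-summable `c`; the weight is needed only through
being at least 1. -/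

section OrthonormalSeries

variable {ι 𝕜 E : Type*} [RCLike 𝕜] [NormedAddCommGroup E] [InnerProductSpace 𝕜 E]

theorem Orthonormal.norm_sq_sum_smul {v : ι → E} (hv : Orthonormal 𝕜 v) (c : ι → 𝕜)
    (s : Finset ι) : ‖∑ i ∈ s, c i • v i‖ ^ 2 = ∑ i ∈ s, ‖c i‖ ^ 2 := by
  simpa using hv.orthogonalFamily.norm_sum c s

theorem Orthonormal.summable_smul [CompleteSpace E] {v : ι → E} (hv : Orthonormal 𝕜 v)
    {c : ι → 𝕜} (hc : Summable fun i => ‖c i‖ ^ 2) : Summable fun i => c i • v i := by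
  simpa using (hv.orthogonalFamily.summable_iff_norm_sq_summable c).2 hc

theorem Orthonormal.norm_sq_tsum_smul_le [CompleteSpace E] {v : ι → E} (hv : Orthonormal 𝕜 v)
    {c : ι → 𝕜} (hc : Summable fun i => ‖c i‖ ^ 2) :
    ‖∑' i, c i • v i‖ ^ 2 ≤ ∑' i, ‖c i‖ ^ 2 := by
  have h := ((hv.summable_smul hc).hasSum.norm.pow 2)
  refine le_of_tendsto h (Filter.Eventually.of_forall fun s => ?_)
  rw [hv.norm_sq_sum_smul]
  exact hc.sum_le_tsum s fun i _ => by positivity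

end OrthonormalSeries

theorem integral_exp_int_mul_I_Ioo (k : ℤ) :
    ∫ t in Set.Ioo (-(4 * Real.pi / 2)) (4 * Real.pi / 2),
      Complex.exp (Complex.I * (k : ℂ) * (t : ℂ)) = if k = 0 then (4 * Real.pi : ℂ) else 0 := by
  have hpi := Real.pi_pos
  rw [← integral_Ioc_eq_integral_Ioo, ← intervalIntegral.integral_of_le (by linarith)]
  split_ifs with hk
  · subst hk
    simp
  · have hne : Complex.I * (k : ℂ) ≠ 0 := by simp [hk]
    rw [integral_exp_mul_complex hne, div_eq_zero_iff]
    left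
    rw [sub_eq_zero, Complex.exp_eq_exp_iff_exists_int]
    -- The interval spans two periods of length `2π`, hence the factor 2.
    refine ⟨2 * k, ?_⟩
    push_cast
    ring

/-- The frequencies `m⁵ + m³ - m` of the exponentials `t ↦ e^{-λ_m t}`. -/
def kawaharaFrequency (m : ℤ) : ℤ := m * (m ^ 4 + m ^ 2 - 1)

theorem neg_kawaharaEigenvalue (m : ℤ) :
    -kawaharaEigenvalue m = Complex.I * (kawaharaFrequency m : ℂ) := by
  simp only [kawaharaEigenvalue, kawaharaFrequency]
  push_cast
  ring

/-- With `p = m(m+1)`, the increment is `5p² + 8p + 1`, and `p ≥ 0` because `m` is an integer; over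
the reals monotonicity fails near 0. Injectivity is what orthogonality uses. -/
theorem kawaharaFrequency_strictMono : StrictMono kawaharaFrequency := by
  refine strictMono_int_of_lt_succ fun m => ?_
  simp only [kawaharaFrequency]
  nlinarith [sq_nonneg (m * (m + 1)), mul_self_nonneg (2 * m + 1),
    show 0 ≤ m * (m + 1) by rcases le_or_gt 0 m with h | h <;> nlinarith]

theorem conj_exp_kawahara (n : ℤ) (t : ℝ) :
    (starRingEnd ℂ) (Complex.exp (-kawaharaEigenvalue n * (t : ℂ))) =
      Complex.exp (-(Complex.I * (kawaharaFrequency n : ℂ) * (t : ℂ))) := by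
  rw [neg_kawaharaEigenvalue, ← Complex.exp_conj]
  simp

theorem integral_exp_kawahara_mul_conj (m n : ℤ) :
    ∫ t in Set.Ioo (-(4 * Real.pi / 2)) (4 * Real.pi / 2),
      Complex.exp (-kawaharaEigenvalue m * (t : ℂ)) *
        (starRingEnd ℂ) (Complex.exp (-kawaharaEigenvalue n * (t : ℂ))) =
      if m = n then (4 * Real.pi : ℂ) else 0 := by
  have h := integral_exp_int_mul_I_Ioo (kawaharaFrequency m - kawaharaFrequency n)
  simp only [sub_eq_zero, kawaharaFrequency_strictMono.injective.eq_iff] at h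
  rw [← h]
  congr 1 with t
  rw [conj_exp_kawahara, neg_kawaharaEigenvalue, ← Complex.exp_add]
  push_cast
  ring_nf

theorem memLp_exp_kawahara (m : ℤ) (T : ℝ) :
    MemLp (fun t : ℝ => Complex.exp (-kawaharaEigenvalue m * (t : ℂ))) 2
      (volume.restrict (Set.Ioo (-(T / 2)) (T / 2))) := by
  refine MemLp.of_bound (by fun_prop) 1 (Filter.Eventually.of_forall fun t => ?_)
  rw [neg_kawaharaEigenvalue, Complex.norm_exp]
  simp

/-- The exponential `t ↦ e^{-λ_m t}` as an element of `L²(-T/2, T/2)`. -/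
noncomputable def kawaharaExp (T : ℝ) (m : ℤ) : SymmL2 T := (memLp_exp_kawahara m T).toLp _

theorem coeFn_kawaharaExp (T : ℝ) (m : ℤ) :
    kawaharaExp T m =ᵐ[volume.restrict (Set.Ioo (-(T / 2)) (T / 2))]
      fun t : ℝ => Complex.exp (-kawaharaEigenvalue m * (t : ℂ)) :=
  (memLp_exp_kawahara m T).coeFn_toLp

theorem inner_kawaharaExp (m n : ℤ) :
    inner ℂ (kawaharaExp (4 * Real.pi) n) (kawaharaExp (4 * Real.pi) m) =
      if m = n then (4 * Real.pi : ℂ) else 0 := by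
  rw [← integral_exp_kawahara_mul_conj, L2.inner_def]
  refine integral_congr_ae ?_
  filter_upwards [coeFn_kawaharaExp (4 * Real.pi) m, coeFn_kawaharaExp (4 * Real.pi) n]
    with t hm hn
  rw [hm, hn]
  simp [mul_comm]

theorem orthonormal_kawaharaExp :
    Orthonormal ℂ fun m =>
      ((√(4 * Real.pi))⁻¹ : ℂ) • kawaharaExp (4 * Real.pi) m := by
  have hsq : ((√(4 * Real.pi) : ℝ) : ℂ) * (√(4 * Real.pi) : ℝ) = 4 * Real.pi := by
    rw [← Complex.ofReal_mul, Real.mul_self_sqrt (by positivity)]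
    push_cast
    rfl
  rw [orthonormal_iff_ite]
  intro m n
  rw [inner_smul_left, inner_smul_right, inner_kawaharaExp, map_inv₀, Complex.conj_ofReal]
  by_cases h : m = n
  · have : (4 * Real.pi : ℂ) ≠ 0 := by simp [Real.pi_ne_zero]
    rw [if_pos h.symm, if_pos h, ← mul_assoc, ← mul_inv, hsq, inv_mul_cancel₀ this]
  · rw [if_neg (Ne.symm h), if_neg h, mul_zero, mul_zero]

theorem isBiorthogonal_kawaharaExp :
    IsBiorthogonal (4 * Real.pi)
      (fun m => ((4 * Real.pi)⁻¹ : ℂ) • kawaharaExp (4 * Real.pi) m)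
      (fun n t => Complex.exp (-kawaharaEigenvalue n * (t : ℂ))) := by
  intro m n
  have hpi : (4 * Real.pi : ℂ) ≠ 0 := by simp [Real.pi_ne_zero]
  have h : ∫ t in Set.Ioo (-(4 * Real.pi / 2)) (4 * Real.pi / 2),
      (((4 * Real.pi)⁻¹ : ℂ) • kawaharaExp (4 * Real.pi) m : SymmL2 (4 * Real.pi)) t *
        (starRingEnd ℂ) (Complex.exp (-kawaharaEigenvalue n * (t : ℂ))) =
      ∫ t in Set.Ioo (-(4 * Real.pi / 2)) (4 * Real.pi / 2),
        ((4 * Real.pi)⁻¹ : ℂ) * (Complex.exp (-kawaharaEigenvalue m * (t : ℂ)) *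
        (starRingEnd ℂ) (Complex.exp (-kawaharaEigenvalue n * (t : ℂ)))) := by
    refine integral_congr_ae ?_
    filter_upwards [coeFn_kawaharaExp (4 * Real.pi) m,
      Lp.coeFn_smul ((4 * Real.pi)⁻¹ : ℂ) (kawaharaExp (4 * Real.pi) m)] with t hm hs
    rw [hs, Pi.smul_apply, hm, smul_eq_mul, mul_assoc]
  rw [h, integral_const_mul, integral_exp_kawahara_mul_conj]
  split_ifs
  · exact inv_mul_cancel₀ hpi
  · exact mul_zero _

theorem theorem2p2 :
    ∃ T b C : ℝ, 2 * Real.pi < T ∧ 0 < b ∧ 0 < C ∧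
      ∃ ζ : ℤ → SymmL2 T,
        IsBiorthogonal T ζ (fun n t => Complex.exp (-kawaharaEigenvalue n * (t : ℂ))) ∧
        ∀ c : ℤ → ℂ,
          Summable (fun m : ℤ => ‖c m‖ ^ 2 * Real.exp (2 * b * (m : ℝ) ^ 6)) →
            Summable (fun m : ℤ => c m • ζ m) ∧
            ‖∑' m : ℤ, c m • ζ m‖ ^ 2 ≤
              C * ∑' m : ℤ, ‖c m‖ ^ 2 * Real.exp (2 * b * (m : ℝ) ^ 6) := by
  have hpi := Real.pi_pos
  -- `4π` is the least multiple of `2π` exceeding `2π`; any `b > 0` would do.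
  refine ⟨4 * Real.pi, 1, (4 * Real.pi)⁻¹, by linarith, one_pos, by positivity,
    _, isBiorthogonal_kawaharaExp, fun c hc => ?_⟩
  have hle : ∀ m : ℤ, ‖c m‖ ^ 2 ≤ ‖c m‖ ^ 2 * Real.exp (2 * 1 * (m : ℝ) ^ 6) := fun m =>
    le_mul_of_one_le_right (by positivity) (Real.one_le_exp (by positivity))
  have hc' : Summable fun m : ℤ => ‖c m‖ ^ 2 :=
    hc.of_nonneg_of_le (fun m => by positivity) hle
  have hsq : ((√(4 * Real.pi) : ℝ) : ℂ)⁻¹ * ((√(4 * Real.pi) : ℝ) : ℂ)⁻¹ =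
      ((4 * Real.pi)⁻¹ : ℂ) := by
    rw [← mul_inv, ← Complex.ofReal_mul, Real.mul_self_sqrt (by positivity)]
    push_cast
    rfl
  -- One factor `1/√(4π)` normalises the exponential; the other comes out of the sum and, squared,
  -- is the constant `C`.
  have hterm : ∀ m : ℤ, c m • ((4 * Real.pi)⁻¹ : ℂ) • kawaharaExp (4 * Real.pi) m =
      ((√(4 * Real.pi) : ℝ) : ℂ)⁻¹ •
        (c m • ((√(4 * Real.pi))⁻¹ : ℂ) • kawaharaExp (4 * Real.pi) m) := fun m => by
    rw [← hsq, mul_smul, smul_comm (c m)]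
  have hsum := orthonormal_kawaharaExp.summable_smul hc'
  simp only [hterm]
  refine ⟨hsum.const_smul _, ?_⟩
  rw [hsum.tsum_const_smul, norm_smul, mul_pow, norm_inv, Complex.norm_real,
    Real.norm_of_nonneg (Real.sqrt_nonneg _), inv_pow, Real.sq_sqrt (by positivity)]
  gcongr
  exact (orthonormal_kawaharaExp.norm_sq_tsum_smul_le hc').trans (hc'.tsum_le_tsum hle hc)
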